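/- For real numbers $a,b>0$ and $r\in\mathbb R$, let $$C_r(a,b)=\Big(\frac{b^r+a^r}{b+a}\Big)^{\frac1{r-1}}\quad (r\neq 1),\qquad C_1(a,b)=\lim_{r\to1}C_r(a,b)=\big(b^b a^a\big)^{\frac1{b+a}}.$$ Theorem (Lou's Conjecture 2). For every $r\in[0,+\infty)$ and all $b>a>0$, $$C_r(a,b)^2+C_{-r}(a,b)^2<a^2+b^2.$$ -/

import Mathlib

/-- The generalized inverse harmonic mean `C_r(a,b) = ((b^r + a^r)/(b + a))^(1/(r-1))` of two
positive reals, for finite real `r`; at the removable singularity `r = 1` the value is the limit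
`(b^b a^a)^(1/(b+a))` (see `tendsto_genInvHarmonicMean_one`). -/
noncomputable def genInvHarmonicMean (r a b : ℝ) : ℝ :=
  if r = 1 then (b ^ b * a ^ a) ^ (1 / (b + a))
  else ((b ^ r + a ^ r) / (b + a)) ^ (1 / (r - 1))

/-- The value at `r = 1` is the limit of the values at `r ≠ 1`. -/
theorem tendsto_genInvHarmonicMean_one {a b : ℝ} (ha : 0 < a) (hb : 0 < b) :
    Filter.Tendsto (fun r => genInvHarmonicMean r a b) (nhdsWithin 1 {1}ᶜ)
      (nhds (genInvHarmonicMean 1 a b)) := by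
  have hab : 0 < b + a := add_pos hb ha
  set f : ℝ → ℝ := fun r => Real.log ((b ^ r + a ^ r) / (b + a)) with hf
  have hd : HasDerivAt f ((b * Real.log b + a * Real.log a) / (b + a)) 1 := by
    have h1 : HasDerivAt (fun r : ℝ => b ^ r) (b * Real.log b) 1 := by
      simpa using (Real.hasStrictDerivAt_const_rpow hb 1).hasDerivAt
    have h2 : HasDerivAt (fun r : ℝ => a ^ r) (a * Real.log a) 1 := by
      simpa using (Real.hasStrictDerivAt_const_rpow ha 1).hasDerivAt
    have h3 := ((h1.add h2).div_const (b + a)).log (by simp [hab.ne'])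
    simpa [hab.ne'] using h3
  have h1 : f 1 = 0 := by simp [hf, hab.ne']
  have hs := hasDerivAt_iff_tendsto_slope.1 hd
  have hval : genInvHarmonicMean 1 a b
      = Real.exp ((b * Real.log b + a * Real.log a) / (b + a)) := by
    have hpos : 0 < b ^ b * a ^ a := mul_pos (Real.rpow_pos_of_pos hb _) (Real.rpow_pos_of_pos ha _)
    rw [genInvHarmonicMean, if_pos rfl, Real.rpow_def_of_pos hpos,
      Real.log_mul (Real.rpow_pos_of_pos hb _).ne' (Real.rpow_pos_of_pos ha _).ne',
      Real.log_rpow hb, Real.log_rpow ha, mul_one_div]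
  rw [hval]
  refine ((Real.continuous_exp.tendsto _).comp hs).congr' ?_
  filter_upwards [self_mem_nhdsWithin] with r hr
  have hr1 : r ≠ 1 := hr
  have hpos : 0 < (b ^ r + a ^ r) / (b + a) :=
    div_pos (add_pos (Real.rpow_pos_of_pos hb _) (Real.rpow_pos_of_pos ha _)) hab
  rw [genInvHarmonicMean, if_neg hr1, Real.rpow_def_of_pos hpos, Function.comp_apply,
    slope_def_field, h1, sub_zero, mul_one_div]

/-! Write a = e^(m-x) and b = e^(m+x) with x > 0, and put y = rx ≥ 0. Since b^s + a^s = 2 e^(sm)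
cosh(sx), both means are governed by log cosh. With w = `slopeSq x y`, twice the difference quotient
of log cosh in the squared variable, the common factor e^(2m) cancels and the claim becomes
exp(xw(x+y)) + exp(xw(x-y)) < 2 cosh 2x, or equivalently x²w + log cosh(xyw) < log cosh 2x. The
diagonal value of w covers r = 1.

For small x (x ≤ 1/2, or y ≤ x ≤ 4/5), the decrease of tanh u / u bounds log cosh 2x - log cosh(xyw)
below by (1 - (yw/2)²) x tanh 2x (`exp_add_exp_lt_of_quadratic`). Bounds on w then suffice.

For larger x, write log cosh x = x - log 2 + δ(x) with δ(x) = log(1 + e^(-2x)) = `logDefect x`. The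
first exponent falls short of 2x by an explicit multiple of values of δ. Convexity of exp shows that
this loss outweighs the excess of the second term over e^(-2x); the cases x ≤ y
(`exp_add_exp_lt_of_le`) and y < x (`exp_add_exp_lt_of_lt`) need different estimates. -/

open Real Set

namespace LogCosh

/-! ### Bounds and monotonicity for log cosh -/

/-- The logarithm of the hyperbolic cosine. -/
noncomputable def logCosh (x : ℝ) : ℝ := log (cosh x)

theorem hasDerivAt_logCosh (x : ℝ) : HasDerivAt logCosh (sinh x / cosh x) x :=
  (hasDerivAt_cosh x).log (cosh_pos x).ne'

theorem continuous_logCosh : Continuous logCosh :=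
  continuous_iff_continuousAt.2 fun x => (hasDerivAt_logCosh x).continuousAt

@[simp] theorem logCosh_zero : logCosh 0 = 0 := by simp [logCosh]

theorem exp_logCosh (x : ℝ) : exp (logCosh x) = cosh x := exp_log (cosh_pos x)

/-- A function on `[0, ∞)` vanishing at `0` with nonnegative derivative is nonnegative. -/
theorem nonneg_of_hasDerivAt_nonneg {f f' : ℝ → ℝ} (hf : ∀ x, HasDerivAt f (f' x) x)
    (h0 : f 0 = 0) (hf' : ∀ x, 0 < x → 0 ≤ f' x) {x : ℝ} (hx : 0 ≤ x) : 0 ≤ f x := by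
  have hm : MonotoneOn f (Ici 0) := by
    refine monotoneOn_of_deriv_nonneg (convex_Ici 0)
      (fun z _ => (hf z).continuousAt.continuousWithinAt)
      (fun z _ => (hf z).differentiableAt.differentiableWithinAt) fun z hz => ?_
    rw [interior_Ici] at hz
    rw [(hf z).deriv]
    exact hf' z hz
  simpa [h0] using hm (mem_Ici.2 le_rfl) (mem_Ici.2 hx) hx

theorem sinh_le_mul_cosh {x : ℝ} (hx : 0 ≤ x) : sinh x ≤ x * cosh x := by
  have h := nonneg_of_hasDerivAt_nonneg (f := fun x => x * cosh x - sinh x)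
    (f' := fun x => (1 * cosh x + x * sinh x) - cosh x)
    (fun x => ((hasDerivAt_id x).mul (hasDerivAt_cosh x)).sub (hasDerivAt_sinh x)) (by simp)
    (fun x hx => by
      have := mul_nonneg hx.le (sinh_nonneg_iff.2 hx.le)
      linarith) hx
  linarith

theorem le_sinh_mul_cosh {x : ℝ} (hx : 0 ≤ x) : x ≤ sinh x * cosh x := by
  have h1 := self_le_sinh_iff.2 hx
  nlinarith [one_le_cosh x]

theorem three_mul_mul_cosh_le {x : ℝ} (hx : 0 ≤ x) :
    3 * x * cosh x ≤ (3 + x ^ 2) * sinh x := by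
  have h := nonneg_of_hasDerivAt_nonneg (f := fun x => (3 + x ^ 2) * sinh x - 3 * x * cosh x)
    (f' := fun x => x * (x * cosh x - sinh x))
    (fun x => by
      have h1 : HasDerivAt (fun x : ℝ => 3 + x ^ 2) (2 * x) x := by
        simpa using (hasDerivAt_pow 2 x).const_add 3
      have h2 : HasDerivAt (fun x : ℝ => 3 * x) 3 x := by
        simpa using (hasDerivAt_id x).const_mul 3
      refine ((h1.mul (hasDerivAt_sinh x)).sub (h2.mul (hasDerivAt_cosh x))).congr_deriv ?_
      ring) (by simp)
    (fun x hx => mul_nonneg hx.le (sub_nonneg.2 (sinh_le_mul_cosh hx.le))) hx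
  linarith

/-- A rational lower bound for `log cosh`. -/
theorem three_mul_sq_div_le_logCosh {x : ℝ} (hx : 0 ≤ x) :
    3 * x ^ 2 / (6 + x ^ 2) ≤ logCosh x := by
  have h := nonneg_of_hasDerivAt_nonneg (f := fun x => logCosh x - 3 * x ^ 2 / (6 + x ^ 2))
    (f' := fun x => sinh x / cosh x - 36 * x / (6 + x ^ 2) ^ 2)
    (fun x => by
      have h0 : HasDerivAt (fun x : ℝ => x ^ 2) (2 * x) x := by
        simpa using hasDerivAt_pow 2 x
      refine ((hasDerivAt_logCosh x).sub ((h0.const_mul 3).div (h0.const_add 6)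
        (by positivity))).congr_deriv ?_
      congr 1
      field_simp
      ring) (by simp)
    (fun x hx => by
      have hc := cosh_pos x
      have h1 := three_mul_mul_cosh_le hx.le
      have hs := sinh_nonneg_iff.2 hx.le
      rw [sub_nonneg, div_le_div_iff₀ (by positivity) hc]
      -- The comparison 36x/(6+x²)² ≤ 3x/(3+x²) ≤ tanh x has exactly this slack, since (6+x²)² -
      -- 12(3+x²) = x⁴.
      have h2 : 0 ≤ sinh x * x ^ 4 := by positivity
      nlinarith) hx
  linarith

/-- The difference between `log cosh` and its asymptote at infinity. -/
noncomputable def logDefect (x : ℝ) : ℝ := log (1 + exp (-(2 * x)))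

theorem logCosh_eq (x : ℝ) : logCosh x = x - log 2 + logDefect x := by
  have h : cosh x = exp x * (1 + exp (-(2 * x))) / 2 := by
    rw [cosh_eq, mul_add, ← exp_add]
    ring_nf
  rw [logCosh, h, log_div (by positivity) two_ne_zero, log_mul (by positivity) (by positivity),
    log_exp, logDefect]
  ring

theorem logDefect_le (x : ℝ) : logDefect x ≤ exp (-(2 * x)) := by
  linarith [log_le_sub_one_of_pos (show 0 < 1 + exp (-(2 * x)) by positivity),
    show logDefect x = log (1 + exp (-(2 * x))) from rfl]

theorem logCosh_le (x : ℝ) : logCosh x ≤ x - log 2 + exp (-(2 * x)) := by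
  linarith [logCosh_eq x, logDefect_le x]

theorem mul_sinh_div_cosh_le {x : ℝ} (hx : 0 ≤ x) : x * (sinh x / cosh x) ≤ 2 * logCosh x := by
  have h := nonneg_of_hasDerivAt_nonneg (f := fun x => 2 * logCosh x - x * (sinh x / cosh x))
    (f' := fun x => (sinh x * cosh x - x) / cosh x ^ 2)
    (fun x => by
      have hc := (cosh_pos x).ne'
      refine (((hasDerivAt_logCosh x).const_mul 2).sub ((hasDerivAt_id x).mul
        ((hasDerivAt_sinh x).div (hasDerivAt_cosh x) hc))).congr_deriv ?_
      simp only [id, Pi.div_apply]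
      field_simp
      linear_combination (-x) * cosh_sq x) (by simp)
    (fun x hx => div_nonneg (sub_nonneg.2 (le_sinh_mul_cosh hx.le)) (by positivity)) hx
  linarith

theorem antitoneOn_logCosh_div_sq : AntitoneOn (fun x => logCosh x / x ^ 2) (Ioi 0) := by
  have hd : ∀ x ∈ Ioi (0 : ℝ), HasDerivAt (fun x => logCosh x / x ^ 2)
      ((x * (sinh x / cosh x) - 2 * logCosh x) / x ^ 3) x := fun x hx => by
    have hx0 : x ≠ 0 := (mem_Ioi.1 hx).ne'
    refine ((hasDerivAt_logCosh x).div (hasDerivAt_pow 2 x) (by positivity)).congr_deriv ?_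
    have hc := (cosh_pos x).ne'
    field_simp
    push_cast
    ring
  refine antitoneOn_of_deriv_nonpos (convex_Ioi 0)
    (fun z hz => (hd z hz).continuousAt.continuousWithinAt)
    (fun z hz => (hd z (interior_subset hz)).differentiableAt.differentiableWithinAt) fun z hz => ?_
  have hz' := interior_subset hz
  rw [(hd z hz').deriv]
  have : (0 : ℝ) < z := hz'
  exact div_nonpos_of_nonpos_of_nonneg
    (sub_nonpos.2 (mul_sinh_div_cosh_le this.le)) (by positivity)

theorem logCosh_mul_sq_le {x y : ℝ} (hx : 0 ≤ x) (hxy : x ≤ y) :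
    logCosh y * x ^ 2 ≤ logCosh x * y ^ 2 := by
  rcases hx.eq_or_lt with rfl | hx
  · simp
  have hy := hx.trans_le hxy
  have := antitoneOn_logCosh_div_sq (mem_Ioi.2 hx) (mem_Ioi.2 hy) hxy
  exact (div_le_div_iff₀ (by positivity) (by positivity)).1 this

theorem antitoneOn_mul_coth_sub_logCosh :
    AntitoneOn (fun x => x * (cosh x / sinh x) - logCosh x) (Ioi 0) := by
  have hd : ∀ x ∈ Ioi (0 : ℝ), HasDerivAt (fun x => x * (cosh x / sinh x) - logCosh x)
      ((sinh x - x * cosh x) / (sinh x ^ 2 * cosh x)) x := fun x hx => by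
    have hs : sinh x ≠ 0 := (sinh_pos_iff.2 hx).ne'
    have hc := (cosh_pos x).ne'
    refine (((hasDerivAt_id x).mul ((hasDerivAt_cosh x).div (hasDerivAt_sinh x) hs)).sub
      (hasDerivAt_logCosh x)).congr_deriv ?_
    simp only [id, Pi.div_apply]
    field_simp
    linear_combination (sinh x - x * cosh x) * cosh_sq x
  refine antitoneOn_of_deriv_nonpos (convex_Ioi 0)
    (fun z hz => (hd z hz).continuousAt.continuousWithinAt)
    (fun z hz => (hd z (interior_subset hz)).differentiableAt.differentiableWithinAt) fun z hz => ?_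
  have hz' := interior_subset hz
  rw [(hd z hz').deriv]
  have hz0 : (0 : ℝ) < z := hz'
  have hc := cosh_pos z
  exact div_nonpos_of_nonpos_of_nonneg (sub_nonpos.2 (sinh_le_mul_cosh hz0.le)) (by positivity)

/-- After division by tanh y this reads 5/8 < y coth y - log cosh y. The right side decreases to log
2 ≈ 0.693 at infinity, which leaves room for 5/8. -/
theorem sinh_div_cosh_mul_lt {y : ℝ} (hy : 0 < y) :
    sinh y / cosh y * (5 / 4 + 2 * logCosh y) < 2 * y := by
  have hs := sinh_pos_iff.2 hy
  have hc := cosh_pos y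
  -- Instead of a limit, a point z ≥ 2 beyond y is enough: there the function is at least log 2 -
  -- e^(-2z) > log 2 - 1/16 > 5/8.
  obtain ⟨z, hyz, hz2⟩ : ∃ z, y ≤ z ∧ 2 ≤ z := ⟨max y 2, le_max_left _ _, le_max_right _ _⟩
  have hz : 0 < z := by linarith
  have h1 : z * (cosh z / sinh z) - logCosh z ≤ y * (cosh y / sinh y) - logCosh y :=
    antitoneOn_mul_coth_sub_logCosh (mem_Ioi.2 hy) (mem_Ioi.2 hz) hyz
  have h2 : z ≤ z * (cosh z / sinh z) :=
    le_mul_of_one_le_right hz.le ((one_le_div (sinh_pos_iff.2 hz)).2 (sinh_lt_cosh z).le)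
  have h3 := logCosh_le z
  have h4 : exp (-(2 * z)) < 1 / 16 := by
    have h5 : (2 : ℝ) ^ 4 < exp 1 ^ 4 :=
      pow_lt_pow_left₀ (by linarith [exp_one_gt_d9]) (by norm_num) (by norm_num)
    have h6 : exp (1 : ℝ) ^ 4 ≤ exp (2 * z) := by
      rw [← exp_nat_mul]
      exact exp_le_exp.2 (by push_cast; linarith)
    rw [exp_neg, ← one_div]
    exact one_div_lt_one_div_of_lt (by norm_num) (by linarith)
  have h7 : 5 / 8 + logCosh y < y * (cosh y / sinh y) := by linarith [log_two_gt_d9]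
  rw [← mul_div_assoc, lt_div_iff₀ hs] at h7
  rw [div_mul_eq_mul_div, div_lt_iff₀ hc]
  linarith

theorem strictMonoOn_sq_sub_logCosh :
    StrictMonoOn (fun y => y ^ 2 - 5 / 4 * logCosh y - logCosh y ^ 2) (Ici 0) := by
  have hd : ∀ y : ℝ, HasDerivAt (fun y => y ^ 2 - 5 / 4 * logCosh y - logCosh y ^ 2)
      (2 * y - sinh y / cosh y * (5 / 4 + 2 * logCosh y)) y := fun y => by
    refine (((hasDerivAt_pow 2 y).sub ((hasDerivAt_logCosh y).const_mul (5 / 4))).sub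
      ((hasDerivAt_logCosh y).pow 2)).congr_deriv ?_
    push_cast
    ring
  refine strictMonoOn_of_deriv_pos (convex_Ici 0)
    (fun z _ => (hd z).continuousAt.continuousWithinAt) fun z hz => ?_
  rw [interior_Ici] at hz
  rw [(hd z).deriv]
  exact sub_pos.2 (sinh_div_cosh_mul_lt hz)

theorem abs_sinh_div_cosh_le_one (x : ℝ) : |sinh x / cosh x| ≤ 1 := by
  rw [abs_div, abs_of_pos (cosh_pos x), div_le_one (cosh_pos x), abs_le]
  have h1 := cosh_eq x
  have h2 := sinh_eq x
  constructor <;> linarith [exp_pos x, exp_pos (-x)]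

theorem abs_logCosh_sub_le (x y : ℝ) : |logCosh y - logCosh x| ≤ |y - x| := by
  have := convex_univ.norm_image_sub_le_of_norm_hasDerivWithin_le (f := logCosh) (C := 1)
    (fun z _ => (hasDerivAt_logCosh z).hasDerivWithinAt)
    (fun z _ => abs_sinh_div_cosh_le_one z) (mem_univ x) (mem_univ y)
  simpa using this

theorem logCosh_strictMonoOn : StrictMonoOn logCosh (Ici 0) := fun x hx y hy hxy =>
  log_lt_log (cosh_pos x) (by rwa [cosh_lt_cosh, abs_of_nonneg hx, abs_of_nonneg hy])

theorem logCosh_le_sq_div_two (x : ℝ) : logCosh x ≤ x ^ 2 / 2 := by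
  rw [logCosh, log_le_iff_le_exp (cosh_pos x)]
  exact cosh_le_exp_half_sq x

theorem sinh_div_cosh_le_sinh_div_cosh {x y : ℝ} (hxy : x ≤ y) :
    sinh x / cosh x ≤ sinh y / cosh y := by
  rw [div_le_div_iff₀ (cosh_pos x) (cosh_pos y)]
  have := sinh_nonneg_iff.2 (sub_nonneg.2 hxy)
  rw [sinh_sub] at this
  linarith

theorem logCosh_sub_le {x y : ℝ} (hyx : y ≤ x) :
    logCosh x - logCosh y ≤ sinh x / cosh x * (x - y) := by
  rcases hyx.eq_or_lt with rfl | hyx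
  · simp
  obtain ⟨c, hc, h⟩ := exists_hasDerivAt_eq_slope logCosh (fun z => sinh z / cosh z) hyx
    continuous_logCosh.continuousOn fun z _ => hasDerivAt_logCosh z
  rw [eq_div_iff (sub_pos.2 hyx).ne'] at h
  rw [← h]
  exact mul_le_mul_of_nonneg_right (sinh_div_cosh_le_sinh_div_cosh hc.2.le) (sub_pos.2 hyx).le

theorem antitoneOn_sinh_div_mul_cosh : AntitoneOn (fun x => sinh x / (x * cosh x)) (Ioi 0) := by
  have hd : ∀ x ∈ Ioi (0 : ℝ), HasDerivAt (fun x => sinh x / (x * cosh x))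
      ((x - sinh x * cosh x) / (x * cosh x) ^ 2) x := fun x hx => by
    have hx0 : x ≠ 0 := (mem_Ioi.1 hx).ne'
    have hc := (cosh_pos x).ne'
    refine ((hasDerivAt_sinh x).div ((hasDerivAt_id x).mul (hasDerivAt_cosh x))
      (mul_ne_zero hx0 hc)).congr_deriv ?_
    simp only [id, Pi.mul_apply]
    congr 1
    linear_combination x * cosh_sq x
  refine antitoneOn_of_deriv_nonpos (convex_Ioi 0)
    (fun z hz => (hd z hz).continuousAt.continuousWithinAt)
    (fun z hz => (hd z (interior_subset hz)).differentiableAt.differentiableWithinAt) fun z hz => ?_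
  have hz' := interior_subset hz
  rw [(hd z hz').deriv]
  exact div_nonpos_of_nonpos_of_nonneg
    (sub_nonpos.2 (le_sinh_mul_cosh (le_of_lt hz'))) (by positivity)

/-- A lower bound for the increments of `log cosh`, sharp to first order at `s = 1`. -/
theorem logCosh_mul_add_le {s u : ℝ} (hs : 0 ≤ s) (hs1 : s ≤ 1) (hu : 0 < u) :
    logCosh (s * u) + (1 - s ^ 2) * (u / 2 * (sinh u / cosh u)) ≤ logCosh u := by
  -- On (0, u] the ratio tanh v / v is at least its value c at u, so log cosh v - cv²/2 increases;
  -- compare v = su with v = u.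
  set c := sinh u / (u * cosh u) with hc
  have hd : ∀ v, HasDerivAt (fun v => logCosh v - v ^ 2 * (c / 2)) (sinh v / cosh v - c * v) v :=
    fun v => by
      refine ((hasDerivAt_logCosh v).sub ((hasDerivAt_pow 2 v).mul_const (c / 2))).congr_deriv ?_
      push_cast
      ring
  have hm : MonotoneOn (fun v => logCosh v - v ^ 2 * (c / 2)) (Icc 0 u) := by
    refine monotoneOn_of_deriv_nonneg (convex_Icc 0 u)
      (fun z _ => (hd z).continuousAt.continuousWithinAt)
      (fun z _ => (hd z).differentiableAt.differentiableWithinAt) fun z hz => ?_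
    rw [interior_Icc] at hz
    rw [(hd z).deriv, sub_nonneg]
    have h : c ≤ sinh z / (z * cosh z) :=
      antitoneOn_sinh_div_mul_cosh (mem_Ioi.2 hz.1) (mem_Ioi.2 hu) hz.2.le
    calc c * z ≤ sinh z / (z * cosh z) * z := mul_le_mul_of_nonneg_right h hz.1.le
      _ = sinh z / cosh z := by
        have := hz.1.ne'
        have := (cosh_pos z).ne'
        field_simp
  have h := hm ⟨mul_nonneg hs hu.le, mul_le_of_le_one_left hu.le hs1⟩ ⟨hu.le, le_rfl⟩
    (mul_le_of_le_one_left hu.le hs1)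
  have h2 : u / 2 * (sinh u / cosh u) = u ^ 2 * (c / 2) := by
    have := (cosh_pos u).ne'
    rw [hc]
    field_simp
  simp only at h
  rw [h2]
  linarith

/-! ### Reduction to inequalities for log cosh -/

theorem exp_add_exp_lt_of_logCosh {x y w : ℝ}
    (h : x ^ 2 * w + logCosh (x * y * w) < logCosh (2 * x)) :
    exp (x * w * (x + y)) + exp (x * w * (x - y)) < exp (2 * x) + exp (-(2 * x)) := by
  have h1 := exp_lt_exp.2 h
  rw [exp_add, exp_logCosh, exp_logCosh, cosh_eq, cosh_eq] at h1
  have h2 : exp (x * w * (x + y)) = exp (x ^ 2 * w) * exp (x * y * w) := by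
    rw [← exp_add]; ring_nf
  have h3 : exp (x * w * (x - y)) = exp (x ^ 2 * w) * exp (-(x * y * w)) := by
    rw [← exp_add]; ring_nf
  rw [h2, h3]
  linarith

theorem exp_add_exp_lt_of_quadratic {x y w : ℝ} (hx : 0 < x) (hy : 0 ≤ y) (hw : 0 < w)
    (hyw : y * w ≤ 2) (h : x ^ 2 * w + x * (sinh (2 * x) / cosh (2 * x)) * ((y * w) ^ 2 / 4) <
      x * (sinh (2 * x) / cosh (2 * x))) :
    exp (x * w * (x + y)) + exp (x * w * (x - y)) < exp (2 * x) + exp (-(2 * x)) := by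
  apply exp_add_exp_lt_of_logCosh
  have h1 := logCosh_mul_add_le (s := y * w / 2) (u := 2 * x) (by positivity) (by linarith)
    (by positivity)
  rw [show y * w / 2 * (2 * x) = x * y * w by ring] at h1
  nlinarith

/-! ### Bounds for the slope of log cosh in the squared variable -/

/-- The slope of `log cosh` with respect to the variable `x ^ 2`, up to a factor `2`. -/
noncomputable def slopeSq (x y : ℝ) : ℝ :=
  if y = x then sinh x / cosh x / x else 2 * (logCosh y - logCosh x) / (y ^ 2 - x ^ 2)

theorem slopeSq_self (x : ℝ) : slopeSq x x = sinh x / cosh x / x := if_pos rfl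

theorem slopeSq_of_ne {x y : ℝ} (h : y ≠ x) :
    slopeSq x y = 2 * (logCosh y - logCosh x) / (y ^ 2 - x ^ 2) := if_neg h

theorem slopeSq_of_ne' {x y : ℝ} (h : y ≠ x) :
    slopeSq x y = 2 * (logCosh x - logCosh y) / (x ^ 2 - y ^ 2) := by
  rw [slopeSq_of_ne h, ← neg_sub (logCosh x), ← neg_sub (x ^ 2), mul_neg, neg_div_neg_eq]

theorem sq_sub_sq_mul_slopeSq {x y : ℝ} (hx : 0 < x) (hy : 0 ≤ y) :
    (y ^ 2 - x ^ 2) * slopeSq x y = 2 * (logCosh y - logCosh x) := by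
  rcases eq_or_ne y x with rfl | h
  · simp
  · have : y ^ 2 - x ^ 2 ≠ 0 := fun h' => h ((pow_left_inj₀ hy hx.le two_ne_zero).1 (by linarith))
    rw [slopeSq_of_ne h]
    field_simp

theorem slopeSq_pos {x y : ℝ} (hx : 0 < x) (hy : 0 ≤ y) : 0 < slopeSq x y := by
  rcases lt_trichotomy y x with h | rfl | h
  · rw [slopeSq_of_ne' h.ne]
    have := logCosh_strictMonoOn (mem_Ici.2 hy) (mem_Ici.2 hx.le) h
    exact div_pos (by linarith) (sub_pos.2 (pow_lt_pow_left₀ h hy two_ne_zero))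
  · rw [slopeSq_self]
    have := sinh_pos_iff.2 hx
    have := cosh_pos y
    positivity
  · rw [slopeSq_of_ne h.ne']
    have := logCosh_strictMonoOn (mem_Ici.2 hx.le) (mem_Ici.2 hy) h
    exact div_pos (by linarith) (sub_pos.2 (pow_lt_pow_left₀ h hx.le two_ne_zero))

/-- As log cosh x / x² decreases, the chord from x² to y² is at most as steep as the chord from 0 to
x². -/
theorem slopeSq_mul_sq_le {x y : ℝ} (hx : 0 < x) (hy : 0 ≤ y) :
    slopeSq x y * x ^ 2 ≤ 2 * logCosh x := by
  rcases lt_trichotomy y x with h | rfl | h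
  · rw [slopeSq_of_ne' h.ne, div_mul_eq_mul_div,
      div_le_iff₀ (sub_pos.2 (pow_lt_pow_left₀ h hy two_ne_zero))]
    linarith [logCosh_mul_sq_le hy h.le]
  · rw [slopeSq_self]
    have := mul_sinh_div_cosh_le hx.le
    calc sinh y / cosh y / y * y ^ 2 = y * (sinh y / cosh y) := by field_simp
      _ ≤ _ := this
  · rw [slopeSq_of_ne h.ne', div_mul_eq_mul_div,
      div_le_iff₀ (sub_pos.2 (pow_lt_pow_left₀ h hx.le two_ne_zero))]
    linarith [logCosh_mul_sq_le hx.le h.le]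

/-- Off the diagonal the left side is twice the ordinary difference quotient of log cosh on [y, x],
and the derivative tanh is increasing. -/
theorem add_mul_slopeSq_le_two_mul {x y : ℝ} (hx : 0 < x) (hy : 0 ≤ y) (h : y ≤ x) :
    (x + y) * slopeSq x y ≤ 2 * (sinh x / cosh x) := by
  rcases h.eq_or_lt with rfl | h
  · rw [slopeSq_self]
    refine le_of_eq ?_
    have := (cosh_pos y).ne'
    field_simp
    ring
  · rw [slopeSq_of_ne' h.ne, ← mul_div_assoc,
      div_le_iff₀ (sub_pos.2 (pow_lt_pow_left₀ h hy two_ne_zero))]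
    have h1 := mul_le_mul_of_nonneg_left (logCosh_sub_le h.le) (add_nonneg hx.le hy)
    linarith

theorem add_mul_slopeSq_le_two {x y : ℝ} (hx : 0 < x) (hy : 0 ≤ y) :
    (x + y) * slopeSq x y ≤ 2 := by
  rcases le_or_gt y x with h | h
  · have := add_mul_slopeSq_le_two_mul hx hy h
    linarith [le_abs_self (sinh x / cosh x), abs_sinh_div_cosh_le_one x]
  · rw [slopeSq_of_ne h.ne', ← mul_div_assoc,
      div_le_iff₀ (sub_pos.2 (pow_lt_pow_left₀ h hx.le two_ne_zero))]
    have h1 := (le_abs_self _).trans (abs_logCosh_sub_le x y)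
    rw [abs_of_pos (sub_pos.2 h)] at h1
    nlinarith

theorem mul_slopeSq_le_two {x y : ℝ} (hx : 0 < x) (hy : 0 ≤ y) : y * slopeSq x y ≤ 2 := by
  have := add_mul_slopeSq_le_two hx hy
  nlinarith [slopeSq_pos hx hy]

/-- Off the diagonal, clearing the denominator turns this into strict monotonicity of y² - (5/4) log
cosh y - (log cosh y)²; on the diagonal it is the sign of the derivative. -/
theorem slopeSq_mul_lt_two {x y : ℝ} (hx : 0 < x) (hy : 0 ≤ y) :
    slopeSq x y * (5 / 4 + logCosh x + logCosh y) < 2 := by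
  rcases lt_trichotomy y x with h | rfl | h
  · rw [slopeSq_of_ne' h.ne, div_mul_eq_mul_div,
      div_lt_iff₀ (sub_pos.2 (pow_lt_pow_left₀ h hy two_ne_zero))]
    have := strictMonoOn_sq_sub_logCosh (mem_Ici.2 hy) (mem_Ici.2 hx.le) h
    simp only at this
    linarith
  · rw [slopeSq_self, div_mul_eq_mul_div, div_lt_iff₀ hx]
    linarith [sinh_div_cosh_mul_lt hx]
  · rw [slopeSq_of_ne h.ne', div_mul_eq_mul_div,
      div_lt_iff₀ (sub_pos.2 (pow_lt_pow_left₀ h hx.le two_ne_zero))]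
    have := strictMonoOn_sq_sub_logCosh (mem_Ici.2 hx.le) (mem_Ici.2 hy) h
    simp only at this
    linarith

/-! ### Small x -/

theorem le_sinh_div_cosh {x : ℝ} (hx : 0 ≤ x) : 3 * x / (3 + x ^ 2) ≤ sinh x / cosh x := by
  rw [div_le_div_iff₀ (by positivity) (cosh_pos x)]
  linarith [three_mul_mul_cosh_le hx]

/-- With T = tanh 2x, both terms to be bounded carry a factor xTw/2: x²w is at most this times 5/4 +
log cosh x, and xT(yw)²/4 at most this times log cosh y. The sum is below xT by
`slopeSq_mul_lt_two`. -/
theorem exp_add_exp_lt_of_le_half {x y : ℝ} (hx : 0 < x) (hx2 : x ≤ 1 / 2) (hy : 0 ≤ y) :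
    exp (x * slopeSq x y * (x + y)) + exp (x * slopeSq x y * (x - y)) <
      exp (2 * x) + exp (-(2 * x)) := by
  have hw := slopeSq_pos hx hy
  have hE := sq_sub_sq_mul_slopeSq hx hy
  have hp := slopeSq_mul_sq_le hx hy
  have hq := slopeSq_mul_lt_two hx hy
  have hyw := mul_slopeSq_le_two hx hy
  set w := slopeSq x y
  apply exp_add_exp_lt_of_quadratic hx hy hw hyw
  have hT := le_sinh_div_cosh (x := 2 * x) (by positivity)
  have hT0 : 0 < sinh (2 * x) / cosh (2 * x) :=
    div_pos (sinh_pos_iff.2 (by positivity)) (cosh_pos _)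
  set T := sinh (2 * x) / cosh (2 * x)
  have hl := three_mul_sq_div_le_logCosh hx.le
  have hX : x ^ 2 ≤ 1 / 4 := by nlinarith
  have h1 : (3 + (2 * x) ^ 2) / 3 ≤ 5 / 4 + 3 * x ^ 2 / (6 + x ^ 2) := by
    rw [← sub_nonneg]
    have : 5 / 4 + 3 * x ^ 2 / (6 + x ^ 2) - (3 + (2 * x) ^ 2) / 3 =
        (18 - 57 * x ^ 2 - 16 * x ^ 4) / (12 * (6 + x ^ 2)) := by
      field_simp
      ring
    rw [this]
    apply div_nonneg _ (by positivity)
    nlinarith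
  have h2 : 2 * x ≤ T * (5 / 4 + logCosh x) := by
    calc 2 * x = 3 * (2 * x) / (3 + (2 * x) ^ 2) * ((3 + (2 * x) ^ 2) / 3) := by field_simp
      _ ≤ T * (5 / 4 + logCosh x) := mul_le_mul hT (h1.trans (by linarith)) (by positivity) hT0.le
  -- Adding `hp` and `hE` gives y²w ≤ 2 log cosh y.
  have h3 : (y * w) ^ 2 / 4 ≤ w * logCosh y / 2 := by nlinarith
  have h4 := mul_le_mul_of_nonneg_left h3 (mul_pos hx hT0).le
  have h5 := mul_le_mul_of_nonneg_left h2 (mul_pos hx hw).le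
  have h6 := mul_lt_mul_of_pos_right hq (mul_pos hx hT0)
  linarith

/-- Here w ≤ 1 and yw ≤ tanh x. Since tanh² x ≤ 9/19, the factor 1 - (yw)²/4 is at least 67/76, and
x < (67/76) tanh 2x finishes. -/
theorem exp_add_exp_lt_of_le_of_le {x y : ℝ} (hx : 0 < x) (hx2 : x ≤ 4 / 5) (hy : 0 ≤ y)
    (hyx : y ≤ x) :
    exp (x * slopeSq x y * (x + y)) + exp (x * slopeSq x y * (x - y)) <
      exp (2 * x) + exp (-(2 * x)) := by
  have hw := slopeSq_pos hx hy
  have hp := (slopeSq_mul_sq_le hx hy).trans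
    (mul_le_mul_of_nonneg_left (logCosh_le_sq_div_two x) two_pos.le)
  have ht := add_mul_slopeSq_le_two_mul hx hy hyx
  have hyw := mul_slopeSq_le_two hx hy
  set w := slopeSq x y
  apply exp_add_exp_lt_of_quadratic hx hy hw hyw
  have hl := le_sinh_div_cosh hx.le
  have hc := cosh_pos x
  have hT : sinh (2 * x) / cosh (2 * x) =
      2 * (sinh x / cosh x) / (1 + (sinh x / cosh x) ^ 2) := by
    rw [sinh_two_mul, cosh_two_mul]
    field_simp
  have ht2 : (sinh x / cosh x) ^ 2 ≤ 9 / 19 := by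
    have h1 : cosh x ^ 2 ≤ 19 / 10 := by
      have h2 : cosh x ≤ exp (8 / 25) := (cosh_le_exp_half_sq x).trans
        (exp_le_exp.2 (by nlinarith))
      have h3 : exp (8 / 25 : ℝ) ^ 2 ≤ 19 / 10 := by
        rw [← exp_nat_mul]
        have h4 := exp_bound' (x := 16 / 25) (by norm_num) (by norm_num) (n := 5) (by norm_num)
        norm_num [Finset.sum_range_succ, Nat.factorial] at h4 ⊢
        linarith
      calc cosh x ^ 2 ≤ exp (8 / 25) ^ 2 := pow_le_pow_left₀ hc.le h2 2
        _ ≤ _ := h3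
    rw [div_pow, sinh_sq, div_le_div_iff₀ (by positivity) (by norm_num)]
    linarith
  have ht0 : 0 < sinh x / cosh x := div_pos (sinh_pos_iff.2 hx) hc
  set t := sinh x / cosh x
  rw [hT]
  set T := 2 * t / (1 + t ^ 2) with hTd
  have hT0 : 0 < T := by positivity
  have hX : x ^ 2 ≤ 16 / 25 := by nlinarith
  have ht1 : t ≤ 1 := by nlinarith
  -- The map t ↦ 2t/(1+t²) increases on [0, 1], so the rational lower bound for tanh x transfers to
  -- tanh 2x.
  have hTl : 6 * x * (3 + x ^ 2) / ((3 + x ^ 2) ^ 2 + 9 * x ^ 2) ≤ T := by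
    set l := 3 * x / (3 + x ^ 2) with hld
    have hl0 : 0 < l := by positivity
    have : 6 * x * (3 + x ^ 2) / ((3 + x ^ 2) ^ 2 + 9 * x ^ 2) = 2 * l / (1 + l ^ 2) := by
      rw [hld]
      field_simp
      ring
    rw [this, hTd, div_le_div_iff₀ (by positivity) (by positivity)]
    have : l * t ≤ 1 := by nlinarith
    nlinarith [mul_nonneg (sub_nonneg.2 hl) (sub_nonneg.2 this)]
  have hxT : x < T * (67 / 76) := by
    refine lt_of_lt_of_le ?_ (mul_le_mul_of_nonneg_right hTl (by norm_num))
    rw [div_mul_eq_mul_div, lt_div_iff₀ (by positivity)]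
    have : (3 + x ^ 2) ^ 2 + 9 * x ^ 2 < 6 * (3 + x ^ 2) * (67 / 76) := by nlinarith
    nlinarith
  have hywt : y * w ≤ t := by nlinarith
  have h1 : (y * w) ^ 2 ≤ 9 / 19 := (pow_le_pow_left₀ (by positivity) hywt 2).trans ht2
  have h2 := mul_le_mul_of_nonneg_left h1 (mul_pos hx hT0).le
  have h3 := mul_lt_mul_of_pos_left hxT hx
  linarith

/-! ### Larger x with x ≤ y -/

theorem exp_logDefect (x : ℝ) : exp (logDefect x) = 1 + exp (-(2 * x)) := exp_log (by positivity)

theorem logDefect_anti {x y : ℝ} (h : x ≤ y) : logDefect y ≤ logDefect x :=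
  log_le_log (by positivity) (by gcongr)

theorem exp_neg_le_one_sub_sinh_div_cosh {x : ℝ} (hx : 0 ≤ x) :
    exp (-(2 * x)) ≤ 1 - sinh x / cosh x := by
  have h : 1 - sinh x / cosh x = exp (-x) / cosh x := by
    rw [← cosh_sub_sinh]
    have := (cosh_pos x).ne'
    field_simp
  rw [h, le_div_iff₀ (cosh_pos x), show -(2 * x) = -x + -x by ring, exp_add, mul_assoc]
  refine mul_le_of_le_one_right (exp_pos _).le ?_
  rw [exp_neg, inv_mul_le_one₀ (exp_pos _), cosh_eq]
  linarith [exp_le_exp.2 (show -x ≤ x by linarith)]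

/-- The function z ↦ (x+z) δ(z) decreases on [x, ∞): δ(z) ≤ e^(-2z) ≤ 1 - tanh z, and x + z ≥ 1
because x ≥ 1/2. -/
theorem add_mul_logDefect_le {x y : ℝ} (hx : 1 / 2 ≤ x) (hxy : x ≤ y) :
    (x + y) * logDefect y ≤ 2 * x * logDefect x := by
  have hd : ∀ z, HasDerivAt (fun z => (x + z) * logDefect z)
      (logDefect z - (x + z) * (1 - sinh z / cosh z)) z := fun z => by
    have h1 : HasDerivAt logDefect (sinh z / cosh z - 1) z :=
      (((hasDerivAt_logCosh z).sub (hasDerivAt_id z)).add_const (log 2)).congr_of_eventuallyEq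
        (Filter.Eventually.of_forall fun u => by
          simp only [Pi.sub_apply, id, logCosh_eq u]
          ring)
    refine (((hasDerivAt_id z).const_add x).mul h1).congr_deriv ?_
    simp only [id]
    ring
  have hm : AntitoneOn (fun z => (x + z) * logDefect z) (Ici x) := by
    refine antitoneOn_of_deriv_nonpos (convex_Ici x)
      (fun z _ => (hd z).continuousAt.continuousWithinAt)
      (fun z _ => (hd z).differentiableAt.differentiableWithinAt) fun z hz => ?_
    rw [interior_Ici] at hz
    have hz : x < z := hz
    rw [(hd z).deriv]
    have h1 := exp_neg_le_one_sub_sinh_div_cosh (show 0 ≤ z by linarith)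
    have h2 := logDefect_le z
    nlinarith [exp_pos (-(2 * z))]
  have := hm (mem_Ici.2 le_rfl) (mem_Ici.2 hxy) hxy
  simp only at this
  linarith

/-- The convexity bound for `exp` on a segment starting at `0`. -/
theorem exp_mul_le_chord {s v : ℝ} (hs : 0 ≤ s) (hs1 : s ≤ 1) :
    exp (s * v) ≤ 1 + s * (exp v - 1) := by
  have := convexOn_exp.2 (mem_univ 0) (mem_univ v) (sub_nonneg.2 hs1) hs (by ring)
  simp only [smul_eq_mul, mul_zero, zero_add, exp_zero] at this
  linarith

/-- This is the chord bound integrated in v. -/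
theorem exp_mul_le_quadratic {s v : ℝ} (hs : 0 ≤ s) (hs1 : s ≤ 1) (hv : 0 ≤ v) :
    exp (s * v) ≤ 1 + s * (v * (1 - s) + s * (exp v - 1)) := by
  have h := nonneg_of_hasDerivAt_nonneg
    (f := fun v => 1 + s * (v * (1 - s) + s * (exp v - 1)) - exp (s * v))
    (f' := fun v => s * (1 + s * (exp v - 1) - exp (s * v)))
    (fun v => by
      have h1 : HasDerivAt (fun v => exp (s * v)) (exp (s * v) * s) v := by
        simpa using ((hasDerivAt_id v).const_mul s).exp
      have h2 : HasDerivAt (fun v => v * (1 - s)) (1 - s) v := by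
        simpa using (hasDerivAt_id v).mul_const (1 - s)
      refine ((((h2.add (((Real.hasDerivAt_exp v).sub_const 1).const_mul s)).const_mul s).const_add
        1).sub h1).congr_deriv ?_
      ring) (by simp)
    (fun v _ => mul_nonneg hs (sub_nonneg.2 (exp_mul_le_chord hs hs1))) hv
  linarith

/-- For P ≥ 0 the first term grows at rate at least 1, while the second falls at rate at most k ≤ 1.
An upper bound for the first exponent may therefore be inserted in both terms. -/
theorem exp_add_exp_neg_mul_le {k P P' : ℝ} (hk : 0 ≤ k) (hk1 : k ≤ 1) (hP : 0 ≤ P)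
    (h : P ≤ P') : exp P + exp (-(k * P)) ≤ exp P' + exp (-(k * P')) := by
  have h1 : P' - P ≤ exp P' - exp P := by
    have h2 := add_one_le_exp (P' - P)
    have h3 : exp P' = exp P * exp (P' - P) := by rw [← exp_add]; ring_nf
    nlinarith [one_le_exp hP]
  have h2 : exp (-(k * P)) - exp (-(k * P')) ≤ P' - P := by
    have h3 := add_one_le_exp (-(k * (P' - P)))
    have h4 : exp (-(k * P')) = exp (-(k * P)) * exp (-(k * (P' - P))) := by
      rw [← exp_add]; ring_nf
    have h5 : exp (-(k * P)) ≤ 1 := exp_le_one_iff.2 (by nlinarith [mul_nonneg hk hP])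
    have h6 : k * (P' - P) ≤ P' - P := mul_le_of_le_one_left (sub_nonneg.2 h) hk1
    have h7 : 0 ≤ k * (P' - P) := mul_nonneg hk (sub_nonneg.2 h)
    nlinarith [exp_pos (-(k * P))]
  linarith

theorem mul_slopeSq_mul_add_le {x y : ℝ} (hx : 1 / 2 ≤ x) (hxy : x ≤ y) :
    x * slopeSq x y * (x + y) ≤ 2 * x - 2 * x / (x + y) * logDefect x := by
  have hx0 : 0 < x := by linarith
  rcases hxy.eq_or_lt with rfl | h
  · have h1 := exp_neg_le_one_sub_sinh_div_cosh hx0.le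
    have h2 := logDefect_le x
    have h3 : x * slopeSq x x * (x + x) = 2 * x * (sinh x / cosh x) := by
      rw [slopeSq_self]
      field_simp
      ring
    rw [h3, show 2 * x / (x + x) = 1 by field_simp; ring]
    nlinarith [exp_pos (-(2 * x))]
  · have hy : 0 < y := hx0.trans h
    have h1 := add_mul_logDefect_le hx hxy
    have h2 : x * slopeSq x y * (x + y) = 2 * x * (logCosh y - logCosh x) / (y - x) := by
      have : y - x ≠ 0 := (sub_pos.2 h).ne'
      rw [slopeSq_of_ne h.ne', show y ^ 2 - x ^ 2 = (y - x) * (x + y) by ring]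
      field_simp
    rw [h2, div_le_iff₀ (sub_pos.2 h), logCosh_eq y, logCosh_eq x]
    have h3 : (2 * x - 2 * x / (x + y) * logDefect x) * (y - x) =
        2 * x * ((y - x) - (y - x) / (x + y) * logDefect x) := by
      field_simp
    rw [h3]
    refine mul_le_mul_of_nonneg_left ?_ (by positivity)
    have h4 : logDefect y ≤ 2 * x * logDefect x / (x + y) := by
      rw [le_div_iff₀ (by positivity)]
      linarith
    have h5 : 2 * x * logDefect x / (x + y) = logDefect x - (y - x) / (x + y) * logDefect x := by
      field_simp
      ring
    linarith

/-- Let A = e^(2x), so e^(δ(x)) = 1 + 1/A. The chord bound makes the first term at most A -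
κA/(A+1); the second must exceed 1/A by less than κA/(A+1). -/
theorem exp_add_exp_lt_of_half_le {x κ : ℝ} (hx : 1 / 2 ≤ x) (hκ : 0 < κ) (hκ1 : κ ≤ 1) :
    exp (2 * x - κ * logDefect x) + exp (-((1 - κ) * (2 * x - κ * logDefect x))) <
      exp (2 * x) + exp (-(2 * x)) := by
  have e1 := exp_mul_le_chord (v := -logDefect x) hκ.le hκ1
  have e2 := exp_mul_le_quadratic (v := 2 * x) hκ.le hκ1 (by linarith)
  have hk0 : 0 ≤ κ * (1 - κ) := mul_nonneg hκ.le (by linarith)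
  have e3 := exp_mul_le_chord (v := logDefect x) (s := κ * (1 - κ)) hk0 (by nlinarith)
  rw [exp_neg, exp_logDefect] at e1
  rw [exp_logDefect] at e3
  have f1 : exp (2 * x - κ * logDefect x) = exp (2 * x) * exp (κ * -logDefect x) := by
    rw [← exp_add]; ring_nf
  have f2 : exp (-((1 - κ) * (2 * x - κ * logDefect x))) =
      exp (-(2 * x)) * (exp (κ * (2 * x)) * exp (κ * (1 - κ) * logDefect x)) := by
    rw [← exp_add, ← exp_add]; ring_nf
  rw [f1, f2]
  have hA := quadratic_le_exp_of_nonneg (show 0 ≤ 2 * x by linarith)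
  have hA1 : 1.718 ≤ exp (2 * x) - 2 * x := by
    have h1 := add_one_le_exp (2 * x - 1)
    have h2 : exp (2 * x) = exp 1 * exp (2 * x - 1) := by rw [← exp_add]; ring_nf
    nlinarith [exp_one_gt_d9]
  have hεA : exp (-(2 * x)) = (exp (2 * x))⁻¹ := exp_neg _
  rw [hεA] at e1 e3 ⊢
  set A := exp (2 * x)
  have hA0 : 2.718 ≤ A := by linarith
  have hAp : 0 < A := by linarith
  have hk : 0 ≤ 1 - κ := by linarith
  have hX := mul_le_mul e2 e3 (exp_pos _).le (by
    have : 0 ≤ A - 1 := by linarith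
    have : 0 ≤ x := by linarith
    positivity)
  -- The term (1-κ)(A-1-2x) is the gain of the quadratic bound over the chord. If A-1-2x ≥ 1 it
  -- suffices; otherwise x ≤ 0.75 and A ≤ 3.5, so 1/(A+1) ≥ 1/4.5 makes up the difference.
  have key : (1 - κ) - (1 - κ) ^ 2 * ((A - 1) / A) < (1 - κ) * (A - 1 - 2 * x) + 1 / (A + 1) := by
    have hB : 0.63 ≤ (A - 1) / A := by
      rw [le_div_iff₀ hAp]
      linarith
    have hB2 := mul_le_mul_of_nonneg_left hB (sq_nonneg (1 - κ))
    rcases le_total 1 (A - 1 - 2 * x) with hg | hg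
    · have : 0 < 1 / (A + 1) := by positivity
      nlinarith
    · have hx1 : x ≤ 0.75 := by nlinarith
      have : 1 / 4.5 ≤ 1 / (A + 1) := one_div_le_one_div_of_le (by positivity) (by linarith)
      nlinarith [sq_nonneg ((1 - κ) - 0.3)]
  have hX2 : (1 + κ * (2 * x * (1 - κ) + κ * (A - 1))) * (1 + κ * (1 - κ) * (1 + A⁻¹ - 1)) - 1 ≤
      κ * (A - 1 - (1 - κ) * (A - 1 - 2 * x) + ((1 - κ) - (1 - κ) ^ 2 * ((A - 1) / A))) := by
    have h0 : 0 ≤ κ * (1 - κ) * A⁻¹ * κ * ((1 - κ) * (A - 1 - 2 * x)) :=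
      mul_nonneg (by positivity) (mul_nonneg hk (by linarith))
    have h1 : (A - 1) / A = 1 - A⁻¹ := by field_simp
    have h2 : A * A⁻¹ = 1 := mul_inv_cancel₀ hAp.ne'
    rw [h1]
    linear_combination h0 + κ ^ 2 * (1 - κ) * h2
  have hX3 : exp (κ * (2 * x)) * exp (κ * (1 - κ) * logDefect x) - 1 < κ * (A ^ 2 / (A + 1)) := by
    have h1 : A ^ 2 / (A + 1) = A - 1 + 1 / (A + 1) := by
      field_simp
      ring
    rw [h1]
    refine (sub_le_sub_right hX 1).trans_lt (hX2.trans_lt (mul_lt_mul_of_pos_left ?_ hκ))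
    linarith
  have hY : A * exp (κ * -logDefect x) ≤ A - κ * (A / (A + 1)) := by
    refine (mul_le_mul_of_nonneg_left e1 hAp.le).trans_eq ?_
    field_simp
    ring
  have hZ := mul_lt_mul_of_pos_left hX3 (inv_pos.2 hAp)
  have hW : A⁻¹ * (κ * (A ^ 2 / (A + 1))) = κ * (A / (A + 1)) := by field_simp
  rw [hW] at hZ
  linarith

theorem exp_add_exp_lt_of_le {x y : ℝ} (hx : 1 / 2 ≤ x) (hxy : x ≤ y) :
    exp (x * slopeSq x y * (x + y)) + exp (x * slopeSq x y * (x - y)) <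
      exp (2 * x) + exp (-(2 * x)) := by
  have hx0 : 0 < x := by linarith
  have hy : 0 < y := by linarith
  have hκ : 0 < 2 * x / (x + y) := by positivity
  have hκ1 : 2 * x / (x + y) ≤ 1 := by
    rw [div_le_one (by positivity)]
    linarith
  have hw := slopeSq_pos hx0 hy.le
  have hQ : x * slopeSq x y * (x - y) =
      -((1 - 2 * x / (x + y)) * (x * slopeSq x y * (x + y))) := by
    field_simp
    ring
  rw [hQ]
  exact (exp_add_exp_neg_mul_le (by linarith) (by linarith) (by positivity)
    (mul_slopeSq_mul_add_le hx hxy)).trans_lt (exp_add_exp_lt_of_half_le hx hκ hκ1)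

/-! ### Larger x with y < x -/

theorem div_add_div_lt_one_add_sq {ε η : ℝ} (hε : 0 < ε) (hε1 : ε ≤ 0.2025) (hη : 0 < η)
    (hη1 : η ≤ 1) :
    (1 + ε) / (1 + ε + 2 * (1 - ε) * η) + η * ((1 + ε) / (1 + η)) < 1 + ε ^ 2 := by
  have h1 : 0 < 1 - ε := by linarith
  rw [← mul_div_assoc, div_add_div _ _ (by positivity) (by positivity),
    div_lt_iff₀ (by positivity), ← sub_pos]
  have h2 : 0 ≤ 1 + 2 * (1 - ε) * η ^ 2 - 2.4 * η := by nlinarith [sq_nonneg (η - 0.8)]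
  -- The smaller root is about 0.204, just above the allowed range ε ≤ 0.2025.
  have h3 : 0 < 1 - 6 * ε + 5.4 * ε ^ 2 := by nlinarith
  have h4 : 0 < η * (1 - 6 * ε + 5.4 * ε ^ 2) := mul_pos hη h3
  have h5 : 0 ≤ ε * (1 - ε) * (η * (1 - η)) :=
    mul_nonneg (by positivity) (mul_nonneg hη.le (by linarith))
  have h6 := mul_nonneg (sq_nonneg ε) h2
  have h7 : 0 ≤ ε ^ 2 * (ε * (1 - η)) := mul_nonneg (by positivity)
    (mul_nonneg hε.le (by linarith))
  have h8 : 0 < ε ^ 2 * η := by positivity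
  linarith

/-- Put ε = e^(-2x), η = e^(-2y), L = δ(y) - δ(x), so e^L = (1+η)/(1+ε). The exponents are 2x - D
with D = 2xL/(x-y), and at most 2x - 2y - L. Division by e^(2x) reduces the claim to e^(-D) + η
e^(-L) < 1 + ε². -/
theorem exp_add_exp_lt_of_lt {x y : ℝ} (hx : 4 / 5 ≤ x) (hy : 0 ≤ y) (hyx : y < x) :
    exp (x * slopeSq x y * (x + y)) + exp (x * slopeSq x y * (x - y)) <
      exp (2 * x) + exp (-(2 * x)) := by
  have hx0 : 0 < x := by linarith
  have hxy : 0 < x - y := sub_pos.2 hyx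
  have hxy' : 0 < x + y := by linarith
  have hL : 0 ≤ logDefect y - logDefect x := sub_nonneg.2 (logDefect_anti hyx.le)
  have hd : logCosh x - logCosh y = x - y - (logDefect y - logDefect x) := by
    rw [logCosh_eq x, logCosh_eq y]
    ring
  have hw : slopeSq x y =
      2 * (x - y - (logDefect y - logDefect x)) / ((x - y) * (x + y)) := by
    rw [slopeSq_of_ne' hyx.ne, hd]
    ring_nf
  have heL : exp (logDefect y - logDefect x) = (1 + exp (-(2 * y))) / (1 + exp (-(2 * x))) := by
    rw [exp_sub, exp_logDefect, exp_logDefect]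
  set L := logDefect y - logDefect x
  set D := 2 * x / (x - y) * L with hD
  have hP : x * slopeSq x y * (x + y) = 2 * x + -D := by
    rw [hw, hD]
    field_simp
    ring
  have hQ : x * slopeSq x y * (x - y) ≤ 2 * x + (-(2 * y) + -L) := by
    have h1 : x * slopeSq x y * (x - y) = 2 * x - 2 * x / (x + y) * (2 * y + L) := by
      rw [hw]
      field_simp
      ring
    have h2 : 1 ≤ 2 * x / (x + y) := by
      rw [le_div_iff₀ hxy']
      linarith
    rw [h1]
    nlinarith
  have hε : 0 < exp (-(2 * x)) := exp_pos _
  have hη : 0 < exp (-(2 * y)) := exp_pos _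
  have hη1 : exp (-(2 * y)) ≤ 1 := exp_le_one_iff.2 (by linarith)
  have hε1 : exp (-(2 * x)) ≤ 0.2025 := by
    have h1 := sum_le_exp_of_nonneg (x := 8 / 5) (by norm_num) 8
    have h2 : exp (8 / 5) ≤ exp (2 * x) := exp_le_exp.2 (by linarith)
    norm_num [Finset.sum_range_succ, Nat.factorial] at h1
    rw [exp_neg, inv_le_comm₀ (exp_pos _) (by norm_num)]
    norm_num
    linarith
  have hτ0 : 0 ≤ (x - y) / x := by positivity
  have hτ1 : (x - y) / x ≤ 1 := by
    rw [div_le_one hx0]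
    linarith
  -- With τ = (x-y)/x, the chord bounds for L = (τ/2)D and for ε = η e^(-2xτ) combine, and τ
  -- cancels: e^D ≥ 1 + 2η(1-ε)/(1+ε).
  have hs := exp_mul_le_chord (v := D) (s := (x - y) / x / 2) (by positivity) (by linarith)
  rw [show (x - y) / x / 2 * D = L by rw [hD]; field_simp, heL] at hs
  have ht := exp_mul_le_chord (v := -(2 * x)) hτ0 hτ1
  have hεη : exp (-(2 * x)) = exp (-(2 * y)) * exp ((x - y) / x * -(2 * x)) := by
    rw [← exp_add]
    congr 1
    field_simp
    ring
  have hA : exp (2 * x) * exp (-(2 * x)) = 1 := by rw [← exp_add]; simp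
  have hlt := div_add_div_lt_one_add_sq hε hε1 hη hη1
  have ht2 := mul_le_mul_of_nonneg_left ht hη.le
  rw [← hεη] at ht2
  have hτ : 0 < (x - y) / x := by positivity
  have hnL : exp (-L) = (1 + exp (-(2 * x))) / (1 + exp (-(2 * y))) := by
    rw [exp_neg, heL, inv_div]
  set τ := (x - y) / x
  set ε := exp (-(2 * x))
  set η := exp (-(2 * y))
  have hDl : (1 + ε + 2 * (1 - ε) * η) / (1 + ε) ≤ exp D := by
    rw [div_le_iff₀ (by positivity)] at hs ⊢
    have : τ * (2 * (1 - ε) * η) ≤ τ * ((exp D - 1) * (1 + ε)) := by linarith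
    linarith [le_of_mul_le_mul_left this hτ]
  have hnD : exp (-D) ≤ (1 + ε) / (1 + ε + 2 * (1 - ε) * η) := by
    have : 0 < 1 - ε := by linarith
    rw [exp_neg, ← inv_div]
    exact inv_anti₀ (by positivity) hDl
  have hQ2 := exp_le_exp.2 hQ
  rw [exp_add, exp_add, hnL] at hQ2
  rw [hP, exp_add]
  have h1 := mul_le_mul_of_nonneg_left hnD (exp_pos (2 * x)).le
  have h2 := mul_lt_mul_of_pos_left hlt (exp_pos (2 * x))
  have h3 : exp (2 * x) * (1 + ε ^ 2) = exp (2 * x) + ε := by linear_combination ε * hA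
  linarith

theorem exp_add_exp_lt {x y : ℝ} (hx : 0 < x) (hy : 0 ≤ y) :
    exp (x * slopeSq x y * (x + y)) + exp (x * slopeSq x y * (x - y)) <
      exp (2 * x) + exp (-(2 * x)) := by
  rcases le_or_gt x y with h | h
  · rcases le_total x (1 / 2) with h1 | h1
    · exact exp_add_exp_lt_of_le_half hx h1 hy
    · exact exp_add_exp_lt_of_le h1 h
  · rcases le_total x (4 / 5) with h1 | h1
    · exact exp_add_exp_lt_of_le_of_le hx h1 hy h.le
    · exact exp_add_exp_lt_of_lt h1 hy h

/-! ### The means in exponential coordinates -/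

theorem exp_rpow_add_exp_rpow (r m x : ℝ) :
    exp (m + x) ^ r + exp (m - x) ^ r = exp (r * m + log 2 + logCosh (r * x)) := by
  rw [← exp_mul, ← exp_mul, exp_add, exp_add, exp_logCosh, exp_log two_pos, cosh_eq,
    show (m + x) * r = r * m + r * x by ring, show (m - x) * r = r * m + -(r * x) by ring,
    exp_add, exp_add]
  ring

theorem exp_add_exp_eq (m x : ℝ) :
    exp (m + x) + exp (m - x) = exp (m + log 2 + logCosh x) := by
  simpa using exp_rpow_add_exp_rpow 1 m x

theorem genInvHarmonicMean_exp_of_ne {r : ℝ} (hr : r ≠ 1) (m x : ℝ) :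
    genInvHarmonicMean r (exp (m - x)) (exp (m + x)) =
      exp (m + (logCosh (r * x) - logCosh x) / (r - 1)) := by
  have : r - 1 ≠ 0 := sub_ne_zero.2 hr
  rw [genInvHarmonicMean, if_neg hr, exp_rpow_add_exp_rpow, exp_add_exp_eq, ← exp_sub, ← exp_mul]
  congr 1
  field_simp
  ring

theorem genInvHarmonicMean_one_exp (m x : ℝ) :
    genInvHarmonicMean 1 (exp (m - x)) (exp (m + x)) = exp (m + x * (sinh x / cosh x)) := by
  have h1 : exp (m + x) + exp (m - x) = 2 * exp m * cosh x := by
    rw [cosh_eq, sub_eq_add_neg, exp_add, exp_add]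
    ring
  have h2 : exp (m + x) - exp (m - x) = 2 * exp m * sinh x := by
    rw [sinh_eq, sub_eq_add_neg m x, exp_add, exp_add]
    ring
  have hc := (cosh_pos x).ne'
  rw [genInvHarmonicMean, if_pos rfl, ← exp_mul, ← exp_mul, ← exp_add, ← exp_mul]
  congr 1
  have h3 : (m + x) * exp (m + x) + (m - x) * exp (m - x) =
      2 * exp m * cosh x * (m + x * (sinh x / cosh x)) := by
    have h4 : 2 * exp m * cosh x * (m + x * (sinh x / cosh x)) =
        m * (2 * exp m * cosh x) + x * (2 * exp m * sinh x) := by field_simp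
    rw [h4, ← h1, ← h2]
    ring
  rw [h3, h1]
  field_simp

theorem genInvHarmonicMean_exp_sq {r x : ℝ} (hr : 0 ≤ r) (hx : 0 < x) (m : ℝ) :
    genInvHarmonicMean r (exp (m - x)) (exp (m + x)) ^ 2 =
      exp (2 * m) * exp (x * slopeSq x (r * x) * (x + r * x)) := by
  rw [← exp_add]
  rcases eq_or_ne r 1 with rfl | h
  · rw [genInvHarmonicMean_one_exp, ← exp_nat_mul, one_mul, slopeSq_self]
    congr 1
    push_cast
    field_simp
    ring
  · have h1 : r - 1 ≠ 0 := sub_ne_zero.2 h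
    have hE := sq_sub_sq_mul_slopeSq hx (mul_nonneg hr hx.le)
    rw [genInvHarmonicMean_exp_of_ne h, ← exp_nat_mul]
    congr 1
    push_cast
    field_simp
    linear_combination -hE

theorem genInvHarmonicMean_neg_exp_sq {r x : ℝ} (hr : 0 ≤ r) (hx : 0 < x) (m : ℝ) :
    genInvHarmonicMean (-r) (exp (m - x)) (exp (m + x)) ^ 2 =
      exp (2 * m) * exp (x * slopeSq x (r * x) * (x - r * x)) := by
  have h1 : -r - 1 ≠ 0 := by linarith
  have hE := sq_sub_sq_mul_slopeSq hx (mul_nonneg hr hx.le)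
  have hn : logCosh (-r * x) = logCosh (r * x) := by simp [logCosh]
  rw [genInvHarmonicMean_exp_of_ne (by linarith), ← exp_nat_mul, ← exp_add, hn]
  congr 1
  push_cast
  field_simp
  linear_combination -hE

end LogCosh

open LogCosh in
theorem theorem4p2 (r a b : ℝ) (hr : 0 ≤ r) (ha : 0 < a) (hab : a < b) :
    genInvHarmonicMean r a b ^ 2 + genInvHarmonicMean (-r) a b ^ 2 < a ^ 2 + b ^ 2 := by
  obtain ⟨m, x, hx, rfl, rfl⟩ : ∃ m x, 0 < x ∧ a = exp (m - x) ∧ b = exp (m + x) := by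
    refine ⟨(log a + log b) / 2, (log b - log a) / 2, ?_, ?_, ?_⟩
    · linarith [log_lt_log ha hab]
    · rw [← exp_log ha]; simp only [log_exp]; ring_nf
    · rw [← exp_log (ha.trans hab)]; simp only [log_exp]; ring_nf
  have h1 : exp (m - x) ^ 2 + exp (m + x) ^ 2 =
      exp (2 * m) * (exp (2 * x) + exp (-(2 * x))) := by
    rw [← exp_nat_mul, ← exp_nat_mul, mul_add (exp _), ← exp_add, ← exp_add]
    push_cast
    ring_nf
  rw [genInvHarmonicMean_exp_sq hr hx, genInvHarmonicMean_neg_exp_sq hr hx, h1, ← mul_add]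
  exact mul_lt_mul_of_pos_left (exp_add_exp_lt hx (mul_nonneg hr hx.le)) (exp_pos _)
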